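/- Let $\mathbb F$ be a field. An inverse semivector space over $\mathbb F$ is a commutative additive inverse semigroup $(V,+)$ with a scalar multiplication satisfying $(\alpha+\beta)x=\alpha x+\beta x$, $\alpha(x+y)=\alpha x+\alpha y$, $\alpha(\beta x)=(\alpha\beta)x$ and $1x=x$. Write $0_x:=x+(-x)$, let $\mathcal E(V)$ be the set of additive idempotents, and let $x\preceq y$ mean $x=y+e$ for some $e\in\mathcal E(V)$. A semilattice of associative algebras over $\mathbb F$ is an inverse semivector space $S$ with an associative product such that, for all $x,y,z\in S$, $0\neq\alpha\in\mathbb F$ and $e,f\in\mathcal E(S)$: $\alpha(xy)=(\alpha x)y=x(\alpha y)$; $xy+xz\preceq x(y+z)$; $xy+zy\preceq (x+z)y$; $x(e+z)=xe+xz$; $(x+e)z=xz+ez$; $e+f\preceq ef\preceq f$; and $0_{xy}=0_{x+y}$. A semilattice of Lie algebras over $\mathbb F$ is an inverse semivector space $S$ with a bracket such that, for all $x,y,z\in S$, $0\neq\alpha\in\mathbb F$ and $e,f\in\mathcal E(S)$: $\alpha[x,y]=[\alpha x,y]=[x,\alpha y]$; $[x,y]+[x,z]\preceq[x,y+z]$;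 $[x,y]=-[y,x]$; $[x,e+z]=[x,e]+[x,z]$; $[x,[y,z]]+[y,[z,x]]+[z,[x,y]]\preceq 0_{x+y+z}$; $[e,f]=e+f$; and $0_{[x,y]}=0_{x+y}$. A homomorphism of semilattices of Lie algebras is a map preserving addition, multiplication by scalars and the bracket, which also sends the neutral element to the neutral element whenever both additive semigroups are monoids. **Corollary.** Let $S$ be a semilattice of Lie algebras over $\mathbb F$; if $\operatorname{char}\mathbb F=2$, assume in addition that $[x,x]=0_x$ for all $x\in S$. For $e\in\mathcal E(S)$ let $S_e=\{x\in S: 0_x=e\}$, a Lie algebra under the operations of $S$ with zero element $e$. Order $\mathcal E(S)$ by $\preceq$, a meet semilattice with $e\wedge f=e+f$, and let $F(S)$ be the presheaf of Lie algebras $e\mapsto S_e$ on $\mathcal E(S)$ with restriction maps $S_e\to S_f$, $x\mapsto f+x$, for $f\preceq e$. Let $T$ be the disjoint union $$T=\dot{\bigcup_{e\in\mathcal E(S)}}U(S_e)$$ of the universal enveloping algebras, with scalar multiplication taken in each $U(S_e)$, and with the sum and product of $a\in U(S_e)$ and $b\in U(S_f)$ obtained by applying to $a$ and $b$ the maps $U(S_e)\to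 U(S_{e+f})$ and $U(S_f)\to U(S_{e+f})$ induced by the restriction maps, and then adding or multiplying in $U(S_{e+f})$. Then: 1. $T$ is a semilattice of associative algebras over $\mathbb F$. 2. $T^-$, that is, $T$ with the bracket $[a,b]=ab-ba$, is a semilattice of Lie algebras over $\mathbb F$. 3. The map $S\to T^-$ given on each $S_e$ by the canonical map $S_e\to U(S_e)$ is an injective homomorphism of semilattices of Lie algebras. In particular, $S$ embeds into $T^-$ for some semilattice of associative algebras $T$. -/

import Mathlib

universe u v w

/-! ### Commutative inverse semigroups -/

/-- A commutative additive inverse semigroup.  The element `-x` is the (unique) inverse of `x`. -/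
class AddCommInverseSemigroup (V : Type v) extends AddCommSemigroup V, Neg V where
  add_neg_add : ∀ x : V, x + -x + x = x
  neg_add_neg : ∀ x : V, -x + x + -x = -x

/-- `zeroAt x` is the idempotent `0_x = x + (-x)`. -/
def zeroAt {V : Type v} [AddCommInverseSemigroup V] (x : V) : V := x + -x

/-- The set `𝓔(V)` of additive idempotents. -/
@[ext]
structure AddIdem (V : Type v) [AddCommInverseSemigroup V] : Type v where
  val : V
  idem : val + val = val

/-- The natural partial order: `x ≼ y` iff `x = y + e` for some idempotent `e`. -/
def NatLE {V : Type v} [AddCommInverseSemigroup V] (x y : V) : Prop :=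
  ∃ e : V, e + e = e ∧ x = y + e

/-! ### Inverse semivector spaces and inverse semialgebras -/

/-- An inverse semivector space over the field `F`. -/
class IsInverseSemivectorSpace (F : Type u) [Field F] (V : Type v)
    [AddCommInverseSemigroup V] [SMul F V] : Prop where
  add_smul' : ∀ (a b : F) (x : V), (a + b) • x = a • x + b • x
  smul_add' : ∀ (a : F) (x y : V), a • (x + y) = a • x + a • y
  smul_smul' : ∀ (a b : F) (x : V), a • (b • x) = (a * b) • x
  one_smul' : ∀ x : V, (1 : F) • x = x

/-- A (not necessarily associative) inverse semialgebra over the field `F`. -/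
class IsNonassocInverseSemialgebra (F : Type u) [Field F] (S : Type v)
    [AddCommInverseSemigroup S] [SMul F S] [Mul S] : Prop
    extends IsInverseSemivectorSpace F S where
  smul_mul' : ∀ (a : F) (x y : S), a ≠ 0 → a • (x * y) = (a • x) * y
  mul_smul' : ∀ (a : F) (x y : S), a ≠ 0 → a • (x * y) = x * (a • y)
  mul_add_le : ∀ x y z : S, NatLE (x * y + x * z) (x * (y + z))
  add_mul_le : ∀ x y z : S, NatLE (x * y + z * y) ((x + z) * y)
  mul_idem_add : ∀ x e z : S, e + e = e → x * (e + z) = x * e + x * z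
  add_idem_mul : ∀ x e z : S, e + e = e → (x + e) * z = x * z + e * z
  add_le_idem_mul : ∀ e f : S, e + e = e → f + f = f → NatLE (e + f) (e * f)
  idem_mul_le : ∀ e f : S, e + e = e → f + f = f → NatLE (e * f) f

/-- A semilattice of associative algebras over `F`: an associative inverse semialgebra
in which `0_{xy} = 0_{x+y}`. -/
class IsSemilatticeOfAssociativeAlgebras (F : Type u) [Field F] (S : Type v)
    [AddCommInverseSemigroup S] [SMul F S] [Mul S] : Prop
    extends IsNonassocInverseSemialgebra F S where
  mul_assoc' : ∀ x y z : S, (x * y) * z = x * (y * z)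
  zeroAt_mul : ∀ x y : S, zeroAt (x * y) = zeroAt (x + y)

/-- A Lie inverse semialgebra over the field `F`. -/
class IsLieInverseSemialgebra (F : Type u) [Field F] (S : Type v)
    [AddCommInverseSemigroup S] [SMul F S] [Bracket S S] : Prop
    extends IsInverseSemivectorSpace F S where
  smul_bracket : ∀ (a : F) (x y : S), a ≠ 0 → a • ⁅x, y⁆ = ⁅a • x, y⁆
  bracket_smul : ∀ (a : F) (x y : S), a ≠ 0 → a • ⁅x, y⁆ = ⁅x, a • y⁆
  bracket_add_le : ∀ x y z : S, NatLE (⁅x, y⁆ + ⁅x, z⁆) ⁅x, y + z⁆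
  bracket_skew : ∀ x y : S, ⁅x, y⁆ = -⁅y, x⁆
  bracket_idem_add : ∀ x e z : S, e + e = e → ⁅x, e + z⁆ = ⁅x, e⁆ + ⁅x, z⁆
  jacobi_le : ∀ x y z : S,
    NatLE (⁅x, ⁅y, z⁆⁆ + ⁅y, ⁅z, x⁆⁆ + ⁅z, ⁅x, y⁆⁆) (zeroAt (x + y + z))
  bracket_idem : ∀ e f : S, e + e = e → f + f = f → e + f = ⁅e, f⁆

/-- A semilattice of Lie algebras over `F`: a Lie inverse semialgebra
in which `0_{[x,y]} = 0_{x+y}`. -/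
class IsSemilatticeOfLieAlgebras (F : Type u) [Field F] (S : Type v)
    [AddCommInverseSemigroup S] [SMul F S] [Bracket S S] : Prop
    extends IsLieInverseSemialgebra F S where
  zeroAt_bracket : ∀ x y : S, zeroAt ⁅x, y⁆ = zeroAt (x + y)

/-- Homomorphisms of Lie inverse semialgebras: linear maps preserving the bracket, where a linear
map has to preserve the neutral elements whenever both additive semigroups are monoids. -/
structure IsLieInverseSemialgebraHom (F : Type u) [Field F] {S : Type v} {T : Type w}
    [AddCommInverseSemigroup S] [SMul F S] [Bracket S S]
    [AddCommInverseSemigroup T] [SMul F T] [Bracket T T] (φ : S → T) : Prop where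
  map_add : ∀ x y : S, φ (x + y) = φ x + φ y
  map_smul : ∀ (a : F) (x : S), φ (a • x) = a • φ x
  map_neutral : ∀ (z : S) (t : T), (∀ x, z + x = x) → (∀ y, t + y = y) → φ z = t
  map_bracket : ∀ x y : S, φ ⁅x, y⁆ = ⁅φ x, φ y⁆

/-! ### The commutator bracket -/

/-- `Minus T` is the underlying semivector space of `T`, with the bracket `[x, y] = xy - yx`. -/
def Minus (T : Type v) : Type v := T

instance Minus.instAddCommInverseSemigroup (T : Type v) [h : AddCommInverseSemigroup T] :
    AddCommInverseSemigroup (Minus T) := h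

instance Minus.instSMul (F : Type u) (T : Type v) [h : SMul F T] : SMul F (Minus T) := h

instance Minus.instBracket (T : Type v) [AddCommInverseSemigroup T] [Mul T] :
    Bracket (Minus T) (Minus T) where
  bracket x y :=
    let x' : T := x
    let y' : T := y
    (x' * y' + -(y' * x') : T)

/-! ### Presheaves on meet semilattices -/

/-- A presheaf of Lie algebras over `F` on the meet semilattice `Λ`. -/
structure LieAlgPresheaf (F : Type u) [Field F] (Λ : Type v) [SemilatticeInf Λ] where
  obj : Λ → Type w
  [lieRing : ∀ l, LieRing (obj l)]
  [lieAlgebra : ∀ l, LieAlgebra F (obj l)]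
  res : ∀ {l m : Λ}, m ≤ l → (obj l →ₗ⁅F⁆ obj m)
  res_id : ∀ (l : Λ) (x : obj l), res (le_refl l) x = x
  res_comp : ∀ {l m n : Λ} (h : m ≤ l) (h' : n ≤ m) (x : obj l),
    res h' (res h x) = res (h'.trans h) x

attribute [instance] LieAlgPresheaf.lieRing LieAlgPresheaf.lieAlgebra

/-- A presheaf of (not necessarily unital) associative algebras over `F` on the meet
semilattice `Λ`. -/
structure AssocAlgPresheaf (F : Type u) [Field F] (Λ : Type v) [SemilatticeInf Λ] where
  obj : Λ → Type w
  [ring : ∀ l, NonUnitalRing (obj l)]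
  [module : ∀ l, Module F (obj l)]
  [isScalarTower : ∀ l, IsScalarTower F (obj l) (obj l)]
  [smulCommClass : ∀ l, SMulCommClass F (obj l) (obj l)]
  res : ∀ {l m : Λ}, m ≤ l → (obj l →ₙₐ[F] obj m)
  res_id : ∀ (l : Λ) (x : obj l), res (le_refl l) x = x
  res_comp : ∀ {l m n : Λ} (h : m ≤ l) (h' : n ≤ m) (x : obj l),
    res h' (res h x) = res (h'.trans h) x

attribute [instance] AssocAlgPresheaf.ring AssocAlgPresheaf.module
  AssocAlgPresheaf.isScalarTower AssocAlgPresheaf.smulCommClass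

namespace AssocAlgPresheaf

variable {F : Type u} [Field F] {Λ : Type v} [SemilatticeInf Λ]

/-- The disjoint union `S_P` of the algebras of the presheaf `P`. -/
structure Total (P : AssocAlgPresheaf.{u, v, w} F Λ) : Type (max v w) where
  idx : Λ
  val : P.obj idx

variable (P : AssocAlgPresheaf.{u, v, w} F Λ)

instance : Add P.Total where
  add x y := ⟨x.idx ⊓ y.idx, P.res inf_le_left x.val + P.res inf_le_right y.val⟩

instance : Mul P.Total where
  mul x y := ⟨x.idx ⊓ y.idx, P.res inf_le_left x.val * P.res inf_le_right y.val⟩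

instance : Neg P.Total where
  neg x := ⟨x.idx, -x.val⟩

instance : SMul F P.Total where
  smul a x := ⟨x.idx, a • x.val⟩

theorem Total.ext' {P : AssocAlgPresheaf.{u, v, w} F Λ} {a b : P.Total} (h : a.idx = b.idx)
    (h' : P.res (le_of_eq h.symm) a.val = b.val) : a = b := by
  obtain ⟨l, x⟩ := a
  obtain ⟨m, y⟩ := b
  dsimp only at h
  subst h
  have h2 : x = y := (P.res_id l x).symm.trans h'
  rw [h2]

theorem Total.add_idx (x y : P.Total) : (x + y).idx = x.idx ⊓ y.idx := rfl

theorem Total.neg_idx (x : P.Total) : (-x).idx = x.idx := rfl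

theorem Total.res_add {l : Λ} (x y : P.Total) (h : l ≤ (x + y).idx) :
    P.res h (x + y).val = P.res (h.trans inf_le_left) x.val + P.res (h.trans inf_le_right) y.val := by
  change P.res h (P.res inf_le_left x.val + P.res inf_le_right y.val) = _
  rw [map_add, P.res_comp, P.res_comp]

theorem Total.res_neg {l : Λ} (x : P.Total) (h : l ≤ (-x).idx) :
    P.res h (-x).val = -P.res (show l ≤ x.idx from h) x.val :=
  map_neg _ _

theorem Total.ext_res {x y : P.Total} (h : x.idx = y.idx)
    (h' : P.res (le_of_eq h.symm) x.val = P.res le_rfl y.val) : x = y :=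
  Total.ext' h (h'.trans (P.res_id _ _))

instance : AddCommInverseSemigroup P.Total where
  add_assoc x y z := by
    refine Total.ext_res P (inf_assoc _ _ _) ?_
    rw [Total.res_add, Total.res_add, Total.res_add, Total.res_add, add_assoc]
  add_comm x y := by
    refine Total.ext_res P (inf_comm _ _) ?_
    rw [Total.res_add, Total.res_add, add_comm]
  add_neg_add x := by
    refine Total.ext_res P (by simp [Total.add_idx, Total.neg_idx]) ?_
    rw [Total.res_add, Total.res_add, Total.res_neg]
    simp
  neg_add_neg x := by
    refine Total.ext_res P (by simp [Total.add_idx, Total.neg_idx]) ?_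
    rw [Total.res_add, Total.res_add, Total.res_neg]
    simp

end AssocAlgPresheaf

section Enveloping

attribute [local instance 100] LieRing.ofAssociativeRing

/-- The homomorphism of universal enveloping algebras induced by a Lie algebra homomorphism. -/
noncomputable def envelopingMap (F : Type u) [Field F] {L : Type v} {M : Type w}
    [LieRing L] [LieAlgebra F L] [LieRing M] [LieAlgebra F M] (f : L →ₗ⁅F⁆ M) :
    UniversalEnvelopingAlgebra F L →ₐ[F] UniversalEnvelopingAlgebra F M :=
  UniversalEnvelopingAlgebra.lift F ((UniversalEnvelopingAlgebra.ι F).comp f)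

theorem envelopingMap_ι (F : Type u) [Field F] {L : Type v} {M : Type w}
    [LieRing L] [LieAlgebra F L] [LieRing M] [LieAlgebra F M] (f : L →ₗ⁅F⁆ M) (x : L) :
    envelopingMap F f (UniversalEnvelopingAlgebra.ι F x) = UniversalEnvelopingAlgebra.ι F (f x) :=
  UniversalEnvelopingAlgebra.lift_ι_apply F _ x

theorem envelopingMap_id (F : Type u) [Field F] {L : Type v} [LieRing L] [LieAlgebra F L]
    (f : L →ₗ⁅F⁆ L) (hf : ∀ x, f x = x) : envelopingMap F f = AlgHom.id F _ := by
  apply UniversalEnvelopingAlgebra.hom_ext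
  ext x
  exact (envelopingMap_ι F f x).trans (by rw [hf]; rfl)

theorem envelopingMap_comp (F : Type u) [Field F] {L M N : Type v} [LieRing L] [LieAlgebra F L]
    [LieRing M] [LieAlgebra F M] [LieRing N] [LieAlgebra F N]
    (f : L →ₗ⁅F⁆ M) (g : M →ₗ⁅F⁆ N) (k : L →ₗ⁅F⁆ N) (hk : ∀ x, g (f x) = k x) :
    (envelopingMap F g).comp (envelopingMap F f) = envelopingMap F k := by
  apply UniversalEnvelopingAlgebra.hom_ext
  ext x
  change envelopingMap F g (envelopingMap F f (UniversalEnvelopingAlgebra.ι F x)) =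
    envelopingMap F k (UniversalEnvelopingAlgebra.ι F x)
  rw [envelopingMap_ι, envelopingMap_ι, envelopingMap_ι, hk]

end Enveloping

/-- The universal enveloping algebra functor applied componentwise to a presheaf of Lie
algebras. -/
noncomputable def LieAlgPresheaf.enveloping {F : Type u} [Field F] {Λ : Type v} [SemilatticeInf Λ]
    (P : LieAlgPresheaf.{u, v, w} F Λ) : AssocAlgPresheaf.{u, v, max u w} F Λ where
  obj l := UniversalEnvelopingAlgebra F (P.obj l)
  res h := (envelopingMap F (P.res h) : _ →ₙₐ[F] _)
  res_id l x := by
    change envelopingMap F (P.res (le_refl l)) x = x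
    rw [envelopingMap_id F _ (P.res_id l)]
    rfl
  res_comp h h' x := by
    change envelopingMap F (P.res h') (envelopingMap F (P.res h) x) = _
    rw [← AlgHom.comp_apply, envelopingMap_comp F _ _ _ (P.res_comp h h')]
    rfl

/-! ### The presheaf of Lie algebras of a semilattice of Lie algebras -/

section Idempotents

variable {V : Type v} [AddCommInverseSemigroup V]

theorem aci_neg_unique {x y : V} (h1 : x + y + x = x) (h2 : y + x + y = y) : y = -x := by
  have h3 := AddCommInverseSemigroup.add_neg_add x
  have h4 := AddCommInverseSemigroup.neg_add_neg x
  have e1 : y = y + x + -x := by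
    calc y = y + x + y := h2.symm
      _ = y + (x + -x + x) + y := by rw [h3]
      _ = (y + x + y) + x + -x := by ac_rfl
      _ = y + x + -x := by rw [h2]
  have e2 : -x = y + x + -x := by
    calc -x = -x + x + -x := h4.symm
      _ = -x + (x + y + x) + -x := by rw [h1]
      _ = y + x + (-x + x + -x) := by ac_rfl
      _ = y + x + -x := by rw [h4]
  rw [e1, ← e2]

theorem aci_neg_neg (x : V) : -(-x) = x :=
  (aci_neg_unique (AddCommInverseSemigroup.neg_add_neg x) (AddCommInverseSemigroup.add_neg_add x)).symm

theorem aci_neg_add (x y : V) : -(x + y) = -x + -y := by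
  symm
  apply aci_neg_unique
  · calc x + y + (-x + -y) + (x + y) = (x + -x + x) + (y + -y + y) := by ac_rfl
      _ = x + y := by rw [AddCommInverseSemigroup.add_neg_add, AddCommInverseSemigroup.add_neg_add]
  · calc -x + -y + (x + y) + (-x + -y) = (-x + x + -x) + (-y + y + -y) := by ac_rfl
      _ = -x + -y := by
        rw [AddCommInverseSemigroup.neg_add_neg, AddCommInverseSemigroup.neg_add_neg]

theorem zeroAt_add (x y : V) : zeroAt (x + y) = zeroAt x + zeroAt y := by
  simp only [zeroAt, aci_neg_add]
  ac_rfl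

theorem zeroAt_neg (x : V) : zeroAt (-x) = zeroAt x := by
  simp only [zeroAt, aci_neg_neg]
  ac_rfl

theorem zeroAt_idem (x : V) : zeroAt x + zeroAt x = zeroAt x := by
  unfold zeroAt
  rw [← add_assoc, AddCommInverseSemigroup.add_neg_add]

theorem zeroAt_of_idem {e : V} (h : e + e = e) : zeroAt e = e := by
  have : e = -e := aci_neg_unique (by rw [h, h]) (by rw [h, h])
  rw [zeroAt, ← this, h]

theorem add_zeroAt (x : V) : x + zeroAt x = x := by
  have := AddCommInverseSemigroup.add_neg_add x
  rw [zeroAt, add_comm]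
  exact this

/-- The idempotents form a meet semilattice under the natural partial order, the meet of `e` and
`f` being `e + f`. -/
instance : SemilatticeInf (AddIdem V) where
  le e f := NatLE e.val f.val
  le_refl e := ⟨e.val, e.idem, e.idem.symm⟩
  le_trans e f g := by
    rintro ⟨a, ha, h1⟩ ⟨b, hb, h2⟩
    refine ⟨b + a, ?_, by rw [h1, h2, add_assoc]⟩
    calc b + a + (b + a) = (b + b) + (a + a) := by ac_rfl
      _ = b + a := by rw [ha, hb]
  le_antisymm e f := by
    rintro ⟨a, ha, h1⟩ ⟨b, hb, h2⟩
    apply AddIdem.ext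
    have h3 : e.val = f.val + e.val := by
      calc e.val = f.val + a := h1
        _ = (f.val + f.val) + a := by rw [f.idem]
        _ = f.val + (f.val + a) := by ac_rfl
        _ = f.val + e.val := by rw [← h1]
    have h4 : f.val = e.val + f.val := by
      calc f.val = e.val + b := h2
        _ = (e.val + e.val) + b := by rw [e.idem]
        _ = e.val + (e.val + b) := by ac_rfl
        _ = e.val + f.val := by rw [← h2]
    rw [h4, add_comm, ← h3]
  inf e f := ⟨e.val + f.val, by
    calc e.val + f.val + (e.val + f.val) = (e.val + e.val) + (f.val + f.val) := by ac_rfl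
      _ = e.val + f.val := by rw [e.idem, f.idem]⟩
  inf_le_left e f := ⟨f.val, f.idem, rfl⟩
  inf_le_right e f := ⟨e.val, e.idem, add_comm _ _⟩
  le_inf e f g := by
    rintro ⟨a, ha, h1⟩ ⟨b, hb, h2⟩
    refine ⟨e.val, e.idem, ?_⟩
    calc e.val = e.val + e.val := e.idem.symm
      _ = (f.val + a) + (g.val + b) := by rw [← h1, ← h2]
      _ = ((f.val + f.val) + a) + ((g.val + g.val) + b) := by rw [f.idem, g.idem]
      _ = (f.val + g.val) + ((f.val + a) + (g.val + b)) := by ac_rfl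
      _ = f.val + g.val + e.val := by rw [← h1, ← h2, e.idem]

theorem AddIdem.add_of_le {e f : AddIdem V} (h : e ≤ f) : e.val + f.val = e.val := by
  obtain ⟨a, ha, h1⟩ := h
  calc e.val + f.val = (f.val + f.val) + a := by rw [h1]; ac_rfl
    _ = e.val := by rw [f.idem, ← h1]

theorem NatLE.eq {x y : V} (h : NatLE x y) : x = y + zeroAt x := by
  obtain ⟨e, he, h1⟩ := h
  rw [h1, zeroAt_add, zeroAt_of_idem he, ← add_assoc, add_zeroAt]

end Idempotents

section Component

variable {V : Type v} [AddCommInverseSemigroup V]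

/-- The component `V_e = {x | 0_x = e}`, for an idempotent `e`. -/
@[ext]
structure IdemComponent (V : Type v) [AddCommInverseSemigroup V] (e : AddIdem V) : Type v where
  val : V
  zeroAt_val : zeroAt val = e.val

namespace IdemComponent

variable {e : AddIdem V}

instance : Add (IdemComponent V e) where
  add x y := ⟨x.val + y.val, by rw [zeroAt_add, x.zeroAt_val, y.zeroAt_val, e.idem]⟩

instance : Zero (IdemComponent V e) where
  zero := ⟨e.val, zeroAt_of_idem e.idem⟩

instance : Neg (IdemComponent V e) where
  neg x := ⟨-x.val, by rw [zeroAt_neg, x.zeroAt_val]⟩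

theorem add_idem (x : IdemComponent V e) : x.val + e.val = x.val := by
  have h := add_zeroAt x.val
  rwa [x.zeroAt_val] at h

instance : AddCommGroup (IdemComponent V e) where
  add_assoc x y z := IdemComponent.ext (add_assoc x.val y.val z.val)
  add_comm x y := IdemComponent.ext (add_comm x.val y.val)
  zero_add x := IdemComponent.ext (by
    change e.val + x.val = x.val
    exact (add_comm _ _).trans (IdemComponent.add_idem x))
  add_zero x := IdemComponent.ext (by
    change x.val + e.val = x.val
    exact IdemComponent.add_idem x)
  neg_add_cancel x := IdemComponent.ext (by
    change -x.val + x.val = e.val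
    exact (add_comm _ _).trans x.zeroAt_val)
  nsmul := nsmulRec
  zsmul := zsmulRec

end IdemComponent

open IsInverseSemivectorSpace in
theorem neg_one_smul' (F : Type u) [Field F] [SMul F V] [IsInverseSemivectorSpace F V] (x : V) :
    (-1 : F) • x = -x := by
  have h : ∀ a b : F, a + b + a = a → a • x + b • x + a • x = a • x := fun a b hab => by
    rw [← add_smul', ← add_smul', hab]
  have h1 := h 1 (-1) (by ring)
  have h2 := h (-1) 1 (by ring)
  rw [one_smul'] at h1 h2
  exact aci_neg_unique h1 h2

open IsInverseSemivectorSpace in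
theorem zero_smul_eq_zeroAt (F : Type u) [Field F] [SMul F V] [IsInverseSemivectorSpace F V]
    (x : V) : (0 : F) • x = zeroAt x := by
  rw [zeroAt, ← neg_one_smul' F x]
  nth_rewrite 2 [← one_smul' (F := F) x]
  rw [← add_smul', add_neg_cancel]

open IsInverseSemivectorSpace in
theorem zeroAt_smul (F : Type u) [Field F] [SMul F V] [IsInverseSemivectorSpace F V]
    (a : F) (x : V) : zeroAt (a • x) = zeroAt x := by
  rw [← zero_smul_eq_zeroAt F, ← zero_smul_eq_zeroAt F, smul_smul', zero_mul]

open IsInverseSemivectorSpace in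
theorem smul_idem (F : Type u) [Field F] [SMul F V] [IsInverseSemivectorSpace F V]
    (a : F) {e : V} (he : e + e = e) : a • e = e := by
  rw [← zeroAt_of_idem he, ← zero_smul_eq_zeroAt F, smul_smul', mul_zero]

instance IdemComponent.instSMul {F : Type u} [Field F] [SMul F V] [IsInverseSemivectorSpace F V]
    (e : AddIdem V) : SMul F (IdemComponent V e) where
  smul a x := ⟨a • x.val, by rw [zeroAt_smul, x.zeroAt_val]⟩

open IsInverseSemivectorSpace in
instance IdemComponent.instModule {F : Type u} [Field F] [SMul F V] [IsInverseSemivectorSpace F V]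
    (e : AddIdem V) : Module F (IdemComponent V e) where
  one_smul x := IdemComponent.ext (one_smul' x.val)
  mul_smul a b x := IdemComponent.ext (smul_smul' a b x.val).symm
  smul_zero a := IdemComponent.ext (smul_idem F a e.idem)
  smul_add a x y := IdemComponent.ext (smul_add' a x.val y.val)
  add_smul a b x := IdemComponent.ext (add_smul' a b x.val)
  zero_smul x := IdemComponent.ext ((zero_smul_eq_zeroAt F x.val).trans x.zeroAt_val)

end Component

section LiePresheafOf

open IsLieInverseSemialgebra IsSemilatticeOfLieAlgebras IsInverseSemivectorSpace

variable {F : Type u} [Field F] {S : Type v} [AddCommInverseSemigroup S] [SMul F S] [Bracket S S]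

theorem zeroAt_bracket_eq (hS : IsSemilatticeOfLieAlgebras F S) (x y : S) :
    zeroAt ⁅x, y⁆ = zeroAt x + zeroAt y := by
  rw [hS.zeroAt_bracket, zeroAt_add]

theorem bracket_add_eq (hS : IsSemilatticeOfLieAlgebras F S) (x y z : S) :
    ⁅x, y + z⁆ = ⁅x, y⁆ + ⁅x, z⁆ := by
  have h := (hS.bracket_add_le x y z).eq
  have h2 : zeroAt (⁅x, y⁆ + ⁅x, z⁆) = zeroAt ⁅x, y + z⁆ := by
    simp only [zeroAt_add, zeroAt_bracket_eq hS]
    calc zeroAt x + zeroAt y + (zeroAt x + zeroAt z)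
        = (zeroAt x + zeroAt x) + (zeroAt y + zeroAt z) := by ac_rfl
      _ = _ := by rw [zeroAt_idem]
  rw [h, h2, add_zeroAt]

theorem add_bracket_eq (hS : IsSemilatticeOfLieAlgebras F S) (x y z : S) :
    ⁅x + y, z⁆ = ⁅x, z⁆ + ⁅y, z⁆ := by
  rw [hS.bracket_skew, bracket_add_eq hS, aci_neg_add, ← hS.bracket_skew, ← hS.bracket_skew]

theorem bracket_idem_right (hS : IsSemilatticeOfLieAlgebras F S) (x : S) {e : S}
    (he : e + e = e) : ⁅x, e⁆ = zeroAt x + e := by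
  have h : ⁅x, e⁆ + ⁅x, e⁆ = ⁅x, e⁆ := by rw [← bracket_add_eq hS, he]
  rw [← zeroAt_of_idem h, zeroAt_bracket_eq hS, zeroAt_of_idem he]

theorem bracket_idem_left (hS : IsSemilatticeOfLieAlgebras F S) (x : S) {e : S}
    (he : e + e = e) : ⁅e, x⁆ = e + zeroAt x := by
  have h : ⁅e, x⁆ + ⁅e, x⁆ = ⁅e, x⁆ := by rw [← add_bracket_eq hS, he]
  rw [← zeroAt_of_idem h, zeroAt_bracket_eq hS, zeroAt_of_idem he]

theorem bracket_self_eq (hS : IsSemilatticeOfLieAlgebras F S)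
    (h2 : ringChar F = 2 → ∀ x : S, ⁅x, x⁆ = zeroAt x) (x : S) : ⁅x, x⁆ = zeroAt x := by
  by_cases hF : ringChar F = 2
  · exact h2 hF x
  have hF' : (2 : F) ≠ 0 := Ring.two_ne_zero hF
  have h3 : (2 : F) • ⁅x, x⁆ = zeroAt ⁅x, x⁆ := by
    rw [← one_add_one_eq_two, hS.add_smul', hS.one_smul']
    nth_rewrite 2 [hS.bracket_skew]
    rfl
  have h4 : ⁅x, x⁆ = (2 : F)⁻¹ • ((2 : F) • ⁅x, x⁆) := by
    rw [hS.smul_smul', inv_mul_cancel₀ hF', hS.one_smul']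
  rw [h4, h3, smul_idem F _ (zeroAt_idem _), zeroAt_bracket_eq hS, zeroAt_idem]

theorem jacobi_eq (hS : IsSemilatticeOfLieAlgebras F S) (x y z : S) :
    ⁅x, ⁅y, z⁆⁆ + ⁅y, ⁅z, x⁆⁆ + ⁅z, ⁅x, y⁆⁆ = zeroAt (x + y + z) := by
  rw [(hS.jacobi_le x y z).eq]
  simp only [zeroAt_add, zeroAt_bracket_eq hS]
  have hx := zeroAt_idem x
  have hy := zeroAt_idem y
  have hz := zeroAt_idem z
  generalize zeroAt x = a at *
  generalize zeroAt y = b at *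
  generalize zeroAt z = c at *
  calc a + b + c + (a + (b + c) + (b + (c + a)) + (c + (a + b)))
      = (a + a + (a + a)) + (b + b + (b + b)) + (c + c + (c + c)) := by ac_rfl
    _ = a + b + c := by simp only [hx, hy, hz]

/-- The Lie ring structure on `S_e = {x | 0_x = e}`, with the operations of `S`. -/
@[reducible]
def IdemComponent.lieRing (hS : IsSemilatticeOfLieAlgebras F S)
    (h2 : ringChar F = 2 → ∀ x : S, ⁅x, x⁆ = zeroAt x) (e : AddIdem S) :
    LieRing (IdemComponent S e) where
  bracket x y := ⟨⁅x.val, y.val⁆, by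
    rw [zeroAt_bracket_eq hS, x.zeroAt_val, y.zeroAt_val, e.idem]⟩
  add_lie x y z := IdemComponent.ext (add_bracket_eq hS x.val y.val z.val)
  lie_add x y z := IdemComponent.ext (bracket_add_eq hS x.val y.val z.val)
  lie_self x := IdemComponent.ext ((bracket_self_eq hS h2 x.val).trans x.zeroAt_val)
  leibniz_lie x y z := IdemComponent.ext (by
    change ⁅x.val, ⁅y.val, z.val⁆⁆ = ⁅⁅x.val, y.val⁆, z.val⁆ + ⁅y.val, ⁅x.val, z.val⁆⁆
    have hJ := jacobi_eq hS x.val y.val z.val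
    have e1 : zeroAt (x.val + y.val + z.val) = e.val := by
      rw [zeroAt_add, zeroAt_add, x.zeroAt_val, y.zeroAt_val, z.zeroAt_val, e.idem, e.idem]
    have e2 : ⁅y.val, ⁅z.val, x.val⁆⁆ = -⁅y.val, ⁅x.val, z.val⁆⁆ := by
      rw [hS.bracket_skew z.val x.val, ← neg_one_smul' F ⁅x.val, z.val⁆,
        ← hS.bracket_smul _ _ _ (neg_ne_zero.mpr one_ne_zero), neg_one_smul' F]
    have e3 : ⁅z.val, ⁅x.val, y.val⁆⁆ = -⁅⁅x.val, y.val⁆, z.val⁆ := hS.bracket_skew _ _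
    rw [e1, e2, e3] at hJ
    have hA : zeroAt ⁅⁅x.val, y.val⁆, z.val⁆ = e.val := by
      simp only [zeroAt_bracket_eq hS, x.zeroAt_val, y.zeroAt_val, z.zeroAt_val, e.idem]
    have hB : zeroAt ⁅y.val, ⁅x.val, z.val⁆⁆ = e.val := by
      simp only [zeroAt_bracket_eq hS, x.zeroAt_val, y.zeroAt_val, z.zeroAt_val, e.idem]
    have hC : zeroAt ⁅x.val, ⁅y.val, z.val⁆⁆ = e.val := by
      simp only [zeroAt_bracket_eq hS, x.zeroAt_val, y.zeroAt_val, z.zeroAt_val, e.idem]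
    generalize ⁅x.val, ⁅y.val, z.val⁆⁆ = c at *
    generalize ⁅⁅x.val, y.val⁆, z.val⁆ = a at *
    generalize ⁅y.val, ⁅x.val, z.val⁆⁆ = b at *
    have key : c + zeroAt b + zeroAt a = a + b + e.val := by
      rw [← hJ]
      simp only [zeroAt]
      ac_rfl
    have hc : c + e.val = c := by rw [← hC, add_zeroAt]
    have hb : b + e.val = b := by rw [← hB, add_zeroAt]
    rwa [hA, hB, hc, hc, add_assoc, hb] at key)

/-- The Lie algebra structure on `S_e = {x | 0_x = e}`, with the operations of `S`. -/
@[reducible]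
def IdemComponent.lieAlgebra (hS : IsSemilatticeOfLieAlgebras F S)
    (h2 : ringChar F = 2 → ∀ x : S, ⁅x, x⁆ = zeroAt x) (e : AddIdem S) :
    letI := IdemComponent.lieRing hS h2 e
    LieAlgebra F (IdemComponent S e) :=
  letI := IdemComponent.lieRing hS h2 e
  { (IdemComponent.instModule e : Module F (IdemComponent S e)) with
    lie_smul := fun a x y => IdemComponent.ext (by
      change ⁅x.val, a • y.val⁆ = a • ⁅x.val, y.val⁆
      by_cases ha : a = 0
      · rw [ha, zero_smul_eq_zeroAt F, zero_smul_eq_zeroAt F, zeroAt_bracket_eq hS,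
          bracket_idem_right hS _ (zeroAt_idem _)]
      · exact (hS.bracket_smul a _ _ ha).symm) }

/-- The presheaf `F(S)` of Lie algebras on the meet semilattice of idempotents of a semilattice of
Lie algebras `S`: it sends `e` to `S_e`, and its restriction maps are `x ↦ f + x`.
The hypothesis `h2` is automatic unless the characteristic is two. -/
def liePresheaf (hS : IsSemilatticeOfLieAlgebras F S)
    (h2 : ringChar F = 2 → ∀ x : S, ⁅x, x⁆ = zeroAt x) :
    LieAlgPresheaf.{u, v, v} F (AddIdem S) :=
  letI := IdemComponent.lieRing hS h2
  letI := IdemComponent.lieAlgebra hS h2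
  { obj := fun e => IdemComponent S e
    res := fun {e f} h =>
      { toFun := fun x => ⟨f.val + x.val, by
          rw [zeroAt_add, x.zeroAt_val, zeroAt_of_idem f.idem, AddIdem.add_of_le h]⟩
        map_add' := fun x y => IdemComponent.ext (by
          change f.val + (x.val + y.val) = f.val + x.val + (f.val + y.val)
          calc f.val + (x.val + y.val) = f.val + f.val + (x.val + y.val) := by rw [f.idem]
            _ = _ := by ac_rfl)
        map_smul' := fun a x => IdemComponent.ext (by
          change f.val + a • x.val = a • (f.val + x.val)
          rw [hS.smul_add', smul_idem F a f.idem])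
        map_lie' := fun {x y} => IdemComponent.ext (by
          change f.val + ⁅x.val, y.val⁆ = ⁅f.val + x.val, f.val + y.val⁆
          rw [bracket_add_eq hS, add_bracket_eq hS, add_bracket_eq hS,
            bracket_idem_right hS _ f.idem, bracket_idem_right hS _ f.idem,
            bracket_idem_left hS _ f.idem, zeroAt_of_idem f.idem, f.idem, x.zeroAt_val,
            y.zeroAt_val, add_comm e.val f.val, AddIdem.add_of_le h, f.idem, ← add_assoc,
            f.idem]) }
    res_id := fun e x => IdemComponent.ext (by
      change e.val + x.val = x.val
      rw [add_comm, x.add_idem])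
    res_comp := fun {e f g} h h' x => IdemComponent.ext (by
      change g.val + (f.val + x.val) = g.val + x.val
      rw [← add_assoc, AddIdem.add_of_le h']) }

/-- The disjoint union `T` of the universal enveloping algebras of the components `S_e`, with the
operations induced by the presheaf `e ↦ U(S_e)`. -/
abbrev EnvelopingSemilattice (hS : IsSemilatticeOfLieAlgebras F S)
    (h2 : ringChar F = 2 → ∀ x : S, ⁅x, x⁆ = zeroAt x) : Type (max u v) :=
  (liePresheaf hS h2).enveloping.Total

/-- The map `S → T⁻` given on each component `S_e` by the canonical map `S_e → U(S_e)`. -/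
noncomputable def toEnvelopingSemilattice (hS : IsSemilatticeOfLieAlgebras F S)
    (h2 : ringChar F = 2 → ∀ x : S, ⁅x, x⁆ = zeroAt x) (x : S) :
    Minus (EnvelopingSemilattice hS h2) :=
  let e : AddIdem S := ⟨zeroAt x, zeroAt_idem x⟩
  let x' : (liePresheaf hS h2).obj e := (⟨x, rfl⟩ : IdemComponent S e)
  (⟨e, UniversalEnvelopingAlgebra.ι F x'⟩ : EnvelopingSemilattice hS h2)

end LiePresheafOf

/-!
All the axioms of a semilattice of associative or Lie algebras can be checked after restriction to
a common index, where they become identities in a single associative algebra; this settles the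
claims about the disjoint union `T` and its commutator bracket, for an arbitrary presheaf of
associative algebras (`AssocAlgPresheaf.total_isSemilatticeOfAssociativeAlgebras` and
`AssocAlgPresheaf.minus_total_isSemilatticeOfLieAlgebras`). The restriction of the image of `x` to
an index `e` below `0_x` is the image of `e + x` in `U(S_e)`, so the map `S → T⁻` is a homomorphism
because each `S_e → U(S_e)` is a Lie algebra homomorphism.

Injectivity is the substantial point: each `S_e → U(S_e)` has to be injective, in any
characteristic and dimension, which is the degree-one part of the Poincaré–Birkhoff–Witt theorem
(`PBW.ι_injective`). For a Lie algebra `L` with a linearly ordered basis `x_i`, one lets `L` act on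
the free module on the monomials `z_M`, where `M` runs over the multisets of basis indices:
`x_i z_M = z_{iM}` if `i` is at most every entry of `M`, and otherwise, `j` being the least entry of
`M = jN`, the relation `x_i x_j z_N = x_j x_i z_N + [x_i, x_j] z_N` is used as a definition. As
`x_i z_N = z_{iN} + w` with `w` of degree at most `|N|`, and `x_j z_{iN} = z_{ijN}`, this reads
`x_i z_M = z_{iM} + x_j w + [x_i, x_j] z_N`, a recursion on the degree; it is run
as a sequence of bilinear maps (`PBW.approx`) whose values on a given monomial become stationary
(`PBW.approx_stable`). That the result is a representation is proved by induction on the degree,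
with the Jacobi identity entering where three indices overlap (`PBW.action_comm_basis`). Finally
`x` is recovered from `x z_∅`, so `L` acts faithfully, through its enveloping algebra.
-/

/-! ### The canonical map into the enveloping algebra -/

namespace PBW

open Module

variable {R : Type*} {L : Type*} {I : Type*} [CommRing R] [LieRing L] [LieAlgebra R L]

/-- The ordered monomial `z_M` attached to a multiset `M` of basis indices.  The free module on
these monomials plays the role of the symmetric algebra of `L`. -/
noncomputable def mono (R : Type*) [CommRing R] {I : Type*} (M : Multiset I) : Multiset I →₀ R :=
  Finsupp.single M 1

/-- The span of the monomials of degree at most `n`. -/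
def filtration (R : Type*) [CommRing R] (I : Type*) (n : ℕ) : Submodule R (Multiset I →₀ R) :=
  Finsupp.supported R R {M | M.card ≤ n}

theorem mono_mem_filtration {n : ℕ} {M : Multiset I} (h : M.card ≤ n) :
    mono R M ∈ filtration R I n :=
  Finsupp.single_mem_supported R 1 h

theorem filtration_mono {m n : ℕ} (h : m ≤ n) : filtration R I m ≤ filtration R I n :=
  Finsupp.supported_mono fun _ hM => le_trans hM h

theorem filtration_induction {n : ℕ} {p : (Multiset I →₀ R) → Prop}
    (hmono : ∀ M : Multiset I, M.card ≤ n → p (mono R M)) (hzero : p 0)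
    (hadd : ∀ v w, p v → p w → p (v + w)) (hsmul : ∀ (a : R) v, p v → p (a • v))
    {v : Multiset I →₀ R} (hv : v ∈ filtration R I n) : p v := by
  rw [filtration, Finsupp.supported_eq_span_single] at hv
  induction hv using Submodule.span_induction with
  | mem x hx =>
    obtain ⟨M, hM, rfl⟩ := hx
    exact hmono M hM
  | zero => exact hzero
  | add v w _ _ hv hw => exact hadd v w hv hw
  | smul a v _ hv => exact hsmul a v hv

variable (b : Basis I R L)

theorem basis_induction {p : L → Prop} (hbasis : ∀ i, p (b i)) (hzero : p 0)
    (hadd : ∀ x y, p x → p y → p (x + y)) (hsmul : ∀ (a : R) x, p x → p (a • x)) (x : L) : p x := by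
  induction b.mem_span x using Submodule.span_induction with
  | mem x hx =>
    obtain ⟨i, rfl⟩ := hx
    exact hbasis i
  | zero => exact hzero
  | add x y _ _ hx hy => exact hadd x y hx hy
  | smul a x _ hx => exact hsmul a x hx

/-- Two families of endomorphisms that agree on basis elements and low monomials agree on all of
`L` and on the corresponding piece of the filtration. -/
theorem eq_on_filtration {f g : L →ₗ[R] (Multiset I →₀ R) →ₗ[R] (Multiset I →₀ R)} {n : ℕ}
    (h : ∀ i (M : Multiset I), M.card ≤ n → f (b i) (mono R M) = g (b i) (mono R M))
    (x : L) {v : Multiset I →₀ R} (hv : v ∈ filtration R I n) : f x v = g x v := by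
  refine filtration_induction (p := fun v => f x v = g x v) (fun M hM => ?_) (by simp)
    (fun v w hv hw => ?_) (fun a v hv => ?_) hv
  · have : f.flip (mono R M) = g.flip (mono R M) := b.ext fun i => h i M hM
    exact DFunLike.congr_fun this x
  · rw [map_add, map_add, hv, hw]
  · rw [map_smul, map_smul, hv]

/-- An operation that sends `z_M` to `z_{iM}` up to terms of degree at most `|M|` raises the
filtration by at most one. -/
theorem map_mem_filtration {f : L →ₗ[R] (Multiset I →₀ R) →ₗ[R] (Multiset I →₀ R)} {n : ℕ}
    (h : ∀ i (M : Multiset I), M.card ≤ n →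
      f (b i) (mono R M) - mono R (i ::ₘ M) ∈ filtration R I M.card)
    (x : L) {v : Multiset I →₀ R} (hv : v ∈ filtration R I n) : f x v ∈ filtration R I (n + 1) := by
  refine filtration_induction (p := fun v => f x v ∈ filtration R I (n + 1)) (fun M hM => ?_)
    (by simp) (fun v w hv hw => ?_) (fun a v hv => ?_) hv
  · induction x using basis_induction b with
    | hzero => simp
    | hadd x y hx hy => rw [map_add]; exact add_mem hx hy
    | hsmul a x hx => rw [map_smul]; exact Submodule.smul_mem _ a hx
    | hbasis i =>
      have h1 := filtration_mono (R := R) (hM.trans n.le_succ) (h i M hM)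
      have h2 : mono R (i ::ₘ M) ∈ filtration R I (n + 1) := mono_mem_filtration (by simpa using hM)
      simpa using add_mem h1 h2
  · rw [map_add]; exact add_mem hv hw
  · rw [map_smul]; exact Submodule.smul_mem _ a hv

variable [LinearOrder I]

/-- Either `i` is at most every entry of `M`, or the least entry `j` of `M` is less than `i`. -/
theorem le_all_or_exists_min (i : I) (M : Multiset I) :
    (∀ k ∈ M, i ≤ k) ∨ ∃ j N, M = j ::ₘ N ∧ j < i ∧ ∀ k ∈ N, j ≤ k := by
  by_cases h : ∀ k ∈ M, i ≤ k
  · exact Or.inl h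
  push Not at h
  obtain ⟨k, hk, hki⟩ := h
  obtain ⟨j, hj, hmin⟩ := M.toFinset.exists_min_image id ⟨k, Multiset.mem_toFinset.mpr hk⟩
  obtain ⟨N, rfl⟩ := Multiset.exists_cons_of_mem (Multiset.mem_toFinset.mp hj)
  refine Or.inr ⟨j, N, rfl, (hmin k (Multiset.mem_toFinset.mpr hk)).trans_lt hki, fun l hl => ?_⟩
  exact hmin l (Multiset.mem_toFinset.mpr (Multiset.mem_cons_of_mem hl))

/-- The value `x_i · z_M` prescribed by the commutation relation, when `ρ` is already known to be
the action in lower degrees; `M` is given as its increasing list of entries. -/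
noncomputable def step (ρ : L →ₗ[R] (Multiset I →₀ R) →ₗ[R] (Multiset I →₀ R)) (i : I) :
    List I → (Multiset I →₀ R)
  | [] => mono R {i}
  | j :: N =>
    if i ≤ j then mono R (i ::ₘ j ::ₘ (N : Multiset I))
    else mono R (i ::ₘ j ::ₘ (N : Multiset I)) +
      ρ (b j) (ρ (b i) (mono R (N : Multiset I)) - mono R (i ::ₘ (N : Multiset I))) +
      ρ ⁅b i, b j⁆ (mono R (N : Multiset I))

/-- A sequence of bilinear maps; the `n`-th one is the action of `L` on the monomials of degree at
most `n`, and its values in higher degree are irrelevant. -/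
noncomputable def approx : ℕ → L →ₗ[R] (Multiset I →₀ R) →ₗ[R] (Multiset I →₀ R)
  | 0 => b.constr R fun i => Finsupp.linearCombination R fun M => mono R (i ::ₘ M)
  | n + 1 => b.constr R fun i => Finsupp.linearCombination R fun M =>
      step b (approx n) i (M.sort (· ≤ ·))

theorem approx_zero (i : I) (M : Multiset I) : approx b 0 (b i) (mono R M) = mono R (i ::ₘ M) := by
  simp [approx, mono]

theorem approx_succ (n : ℕ) (i : I) (M : Multiset I) :
    approx b (n + 1) (b i) (mono R M) = step b (approx b n) i (M.sort (· ≤ ·)) := by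
  simp [approx, mono]

theorem approx_of_le (n : ℕ) {i : I} {M : Multiset I} (h : ∀ k ∈ M, i ≤ k) :
    approx b n (b i) (mono R M) = mono R (i ::ₘ M) := by
  cases n with
  | zero => exact approx_zero b i M
  | succ n =>
    rw [approx_succ]
    have hM := Multiset.sort_eq M (· ≤ ·)
    generalize M.sort (· ≤ ·) = l at hM
    subst hM
    cases l with
    | nil => rfl
    | cons j N =>
      rw [step, if_pos (h j (by simp))]
      rfl

theorem approx_cons (n : ℕ) {i j : I} {N : Multiset I} (hji : j < i) (hN : ∀ k ∈ N, j ≤ k) :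
    approx b (n + 1) (b i) (mono R (j ::ₘ N)) = mono R (i ::ₘ j ::ₘ N) +
      approx b n (b j) (approx b n (b i) (mono R N) - mono R (i ::ₘ N)) +
      approx b n ⁅b i, b j⁆ (mono R N) := by
  rw [approx_succ, Multiset.sort_cons _ _ (· ≤ ·) hN, step, if_neg hji.not_ge, Multiset.sort_eq]

/-- The values of `approx` on a monomial are stationary from the degree of the monomial on, and
have the expected leading term. -/
theorem approx_stable (n : ℕ) : ∀ i (M : Multiset I), M.card ≤ n →
    approx b (n + 1) (b i) (mono R M) = approx b n (b i) (mono R M) ∧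
    approx b n (b i) (mono R M) - mono R (i ::ₘ M) ∈ filtration R I M.card := by
  induction n with
  | zero =>
    intro i M hM
    obtain rfl : M = 0 := Multiset.card_eq_zero.mp (Nat.le_zero.mp hM)
    rw [approx_of_le b 1 (by simp), approx_of_le b 0 (by simp)]
    simp
  | succ n ih =>
    intro i M hM
    obtain h | ⟨j, N, rfl, hji, hN⟩ := le_all_or_exists_min i M
    · rw [approx_of_le b _ h, approx_of_le b _ h]
      simp
    · have hNn : N.card ≤ n := by simpa using hM
      obtain ⟨h1, h2⟩ := ih i N hNn
      have heq := fun x {v} hv => eq_on_filtration b (fun i M hM => (ih i M hM).1) x (v := v) hv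
      have hraise := map_mem_filtration b (f := approx b n) (n := N.card)
        fun i M hM => (ih i M (hM.trans hNn)).2
      rw [approx_cons b _ hji hN, approx_cons b _ hji hN, h1,
        heq _ (filtration_mono hNn h2), heq _ (mono_mem_filtration hNn)]
      refine ⟨rfl, ?_⟩
      rw [add_assoc, add_sub_cancel_left, Multiset.card_cons]
      exact add_mem (hraise _ h2) (hraise _ (mono_mem_filtration le_rfl))

/-- The action of `L` on the free module on ordered monomials. -/
noncomputable def action : L →ₗ[R] (Multiset I →₀ R) →ₗ[R] (Multiset I →₀ R) :=
  b.constr R fun i => Finsupp.linearCombination R fun M => approx b M.card (b i) (mono R M)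

theorem action_eq_approx {n : ℕ} (x : L) {v : Multiset I →₀ R} (hv : v ∈ filtration R I n) :
    action b x v = approx b n x v := by
  refine eq_on_filtration b (fun i M hM => ?_) x hv
  have h : action b (b i) (mono R M) = approx b M.card (b i) (mono R M) := by simp [action, mono]
  rw [h]
  clear hv v h
  induction n, hM using Nat.le_induction with
  | base => rfl
  | succ n hn ih => rw [(approx_stable b n i M hn).1, ih]

theorem action_of_le {i : I} {M : Multiset I} (h : ∀ k ∈ M, i ≤ k) :
    action b (b i) (mono R M) = mono R (i ::ₘ M) := by
  rw [action_eq_approx b _ (mono_mem_filtration le_rfl), approx_of_le b _ h]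

theorem action_sub_mem (i : I) (M : Multiset I) :
    action b (b i) (mono R M) - mono R (i ::ₘ M) ∈ filtration R I M.card := by
  rw [action_eq_approx b _ (mono_mem_filtration le_rfl)]
  exact (approx_stable b _ i M le_rfl).2

/-- The commutation relation on `z_N` when one of the two indices is at most all entries of `N`:
this is how the action is defined on the monomial obtained by adding that index. -/
theorem action_comm_of_le {i j : I} {N : Multiset I} (hji : j < i) (hN : ∀ k ∈ N, j ≤ k) :
    action b (b i) (action b (b j) (mono R N)) =
      action b (b j) (action b (b i) (mono R N)) + action b ⁅b i, b j⁆ (mono R N) := by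
  have hmin : ∀ k ∈ i ::ₘ N, j ≤ k := by
    intro k hk
    obtain rfl | hk := Multiset.mem_cons.mp hk
    exacts [hji.le, hN k hk]
  have hself : mono R N ∈ filtration R I N.card := mono_mem_filtration le_rfl
  rw [action_of_le b hN, action_eq_approx b _ (mono_mem_filtration (Multiset.card_cons j N).le),
    approx_cons b _ hji hN, ← action_eq_approx b (b i) hself, ← action_eq_approx b _ hself,
    ← action_eq_approx b _ (action_sub_mem b i N), map_sub, action_of_le b hmin,
    Multiset.cons_swap, add_sub_cancel]

/-- The commutation relation extends linearly from basis elements and monomials. -/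
theorem action_comm_of_basis {n : ℕ}
    (h : ∀ i j (M : Multiset I), M.card ≤ n → action b (b i) (action b (b j) (mono R M)) =
      action b (b j) (action b (b i) (mono R M)) + action b ⁅b i, b j⁆ (mono R M))
    (x y : L) {v : Multiset I →₀ R} (hv : v ∈ filtration R I n) :
    action b x (action b y v) = action b y (action b x v) + action b ⁅x, y⁆ v := by
  refine filtration_induction (p := fun v => action b x (action b y v) =
    action b y (action b x v) + action b ⁅x, y⁆ v) (fun M hM => ?_) (by simp)
    (fun v w hv hw => ?_) (fun a v hv => ?_) hv
  · induction x using basis_induction b with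
    | hzero => simp
    | hadd x x' hx hx' =>
      simp only [map_add, LinearMap.add_apply, add_lie] at hx hx' ⊢
      rw [hx, hx']; abel
    | hsmul a x hx =>
      simp only [map_smul, LinearMap.smul_apply, smul_lie, hx, smul_add]
    | hbasis i =>
      induction y using basis_induction b with
      | hzero => simp
      | hadd x x' hx hx' =>
        simp only [map_add, LinearMap.add_apply, lie_add] at hx hx' ⊢
        rw [hx, hx']; abel
      | hsmul a x hx =>
        simp only [map_smul, LinearMap.smul_apply, lie_smul, hx, smul_add]
      | hbasis j => exact h i j M hM
  · simp only [map_add, hv, hw]; abel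
  · simp only [map_smul, hv, smul_add]

/-- The commutation relation, by induction on the degree; the overlap of three indices
`k < j < i` is resolved by the Jacobi identity. -/
theorem action_comm_basis (n : ℕ) : ∀ i j (M : Multiset I), M.card < n →
    action b (b i) (action b (b j) (mono R M)) =
      action b (b j) (action b (b i) (mono R M)) + action b ⁅b i, b j⁆ (mono R M) := by
  induction n with
  | zero => intro i j M hM; exact absurd hM (Nat.not_lt_zero _)
  | succ n ih =>
    -- It suffices to treat `j < i`, the relation being antisymmetric.
    have main : ∀ i j (M : Multiset I), M.card < n + 1 → j < i →
        action b (b i) (action b (b j) (mono R M)) =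
          action b (b j) (action b (b i) (mono R M)) + action b ⁅b i, b j⁆ (mono R M) := by
      intro i j M hM hji
      obtain h | ⟨k, Q, rfl, hkj, hQ⟩ := le_all_or_exists_min j M
      · exact action_comm_of_le b hji h
      have hQn : Q.card < n := by simpa using hM
      have hmem : mono R Q ∈ filtration R I Q.card := mono_mem_filtration le_rfl
      have comm := fun x y {v} hv => action_comm_of_basis b (n := Q.card)
        (fun i j M hM => ih i j M (hM.trans_lt hQn)) x y (v := v) hv
      -- Moving `x_k` to the front of a product of three generators applied to `z_Q`.
      have expand : ∀ p q, k < p → k < q →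
          action b (b p) (action b (b q) (action b (b k) (mono R Q))) =
            action b (b k) (action b (b p) (action b (b q) (mono R Q))) +
            action b ⁅b p, b k⁆ (action b (b q) (mono R Q)) +
            action b ⁅b q, b k⁆ (action b (b p) (mono R Q)) +
            action b ⁅b p, ⁅b q, b k⁆⁆ (mono R Q) := by
        intro p q hkp hkq
        -- `x_q z_Q` is `z_{qQ}`, to which `action_comm_of_le` applies, plus terms of lower degree.
        have hlow := action_sub_mem b q Q
        have hmin : ∀ l ∈ q ::ₘ Q, k ≤ l := by
          intro l hl
          obtain rfl | hl := Multiset.mem_cons.mp hl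
          exacts [hkq.le, hQ l hl]
        have h1 := comm (b p) (b k) hlow
        have h2 := action_comm_of_le b hkp hmin
        simp only [map_sub] at h1
        have h3 : action b (b p) (action b (b k) (action b (b q) (mono R Q))) =
            action b (b k) (action b (b p) (action b (b q) (mono R Q))) +
              action b ⁅b p, b k⁆ (action b (b q) (mono R Q)) := by
          rw [h2] at h1
          rw [← sub_eq_zero] at h1 ⊢
          rw [← h1]
          abel
        rw [comm (b q) (b k) hmem, map_add, h3, comm (b p) ⁅b q, b k⁆ hmem]
        abel
      rw [← action_of_le b hQ, expand i j (hkj.trans hji) hkj, expand j i hkj (hkj.trans hji),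
        comm (b i) (b j) hmem, comm ⁅b i, b j⁆ (b k) hmem, leibniz_lie (b i) (b j) (b k)]
      simp only [map_add, LinearMap.add_apply]
      abel
    intro i j M hM
    obtain h | rfl | h := lt_trichotomy j i
    · exact main i j M hM h
    · simp
    · rw [main j i M hM h, ← lie_skew (b i) (b j), map_neg, LinearMap.neg_apply]
      abel

theorem action_comm (x y : L) (v : Multiset I →₀ R) :
    action b x (action b y v) = action b y (action b x v) + action b ⁅x, y⁆ v := by
  induction v using Finsupp.induction_linear with
  | zero => simp
  | add v w hv hw => simp only [map_add, hv, hw]; abel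
  | single M a =>
    have hM : Finsupp.single M a ∈ filtration R I M.card :=
      Finsupp.single_mem_supported R a (le_refl M.card)
    exact action_comm_of_basis b
      (fun i j N hN => action_comm_basis b _ i j N (Nat.lt_succ_of_le hN)) x y hM

/-- Applying an element of `L` to the monomial `1 = z_∅` recovers its coordinates. -/
theorem action_mono_zero (x : L) :
    action b x (mono R 0) = (b.repr x).mapDomain fun i => ({i} : Multiset I) := by
  induction x using basis_induction b with
  | hzero => simp
  | hadd x y hx hy => simp [hx, hy, Finsupp.mapDomain_add]
  | hsmul a x hx => simp [hx, Finsupp.mapDomain_smul]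
  | hbasis i =>
    rw [action_of_le b (by simp)]
    simp [mono, Finsupp.mapDomain_single]

section

attribute [local instance 100] LieRing.ofAssociativeRing

/-- The action of `L` on the free module on ordered monomials, as a representation. -/
noncomputable def representation : L →ₗ⁅R⁆ Module.End R (Multiset I →₀ R) :=
  { action b with
    map_lie' := fun {x y} => LinearMap.ext fun v => by
      change action b ⁅x, y⁆ v = action b x (action b y v) - action b y (action b x v)
      rw [action_comm, add_sub_cancel_left] }

/-- A Lie algebra which is free as a module embeds into its universal enveloping algebra: the
enveloping algebra acts on the ordered monomials, and the action of `x` on `z_∅` determines `x`. -/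
theorem ι_injective [Module.Free R L] :
    Function.Injective (UniversalEnvelopingAlgebra.ι R : L → UniversalEnvelopingAlgebra R L) := by
  intro x y hxy
  let b := Module.Free.chooseBasis R L
  -- The choice of the order is immaterial.
  let _ : LinearOrder (Module.Free.ChooseBasisIndex R L) :=
    IsWellOrder.linearOrder WellOrderingRel
  have h : representation b x = representation b y := by
    rw [← UniversalEnvelopingAlgebra.lift_ι_apply R (representation b) x,
      ← UniversalEnvelopingAlgebra.lift_ι_apply R (representation b) y, hxy]
  have h0 : action b x (mono R 0) = action b y (mono R 0) := DFunLike.congr_fun h (mono R 0)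
  rw [action_mono_zero, action_mono_zero] at h0
  exact b.repr.injective (Finsupp.mapDomain_injective (fun _ _ => Multiset.singleton_inj.mp) h0)

end

end PBW

/-! ### The total space of a presheaf of associative algebras -/

namespace AssocAlgPresheaf

variable {F : Type u} [Field F] {Λ : Type v} [SemilatticeInf Λ]
  {P : AssocAlgPresheaf.{u, v, w} F Λ}

namespace Total

/-- Elements over the same index are equal once all their restrictions agree. -/
theorem ext_forall {x y : P.Total} (h : x.idx = y.idx)
    (h' : ∀ l (hx : l ≤ x.idx) (hy : l ≤ y.idx), P.res hx x.val = P.res hy y.val) : x = y :=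
  ext_res P h (h' _ _ _)

theorem mul_idx (x y : P.Total) : (x * y).idx = x.idx ⊓ y.idx := rfl

theorem smul_idx (a : F) (x : P.Total) : (a • x).idx = x.idx := rfl

theorem zeroAt_idx (x : P.Total) : (zeroAt x).idx = x.idx := inf_idem x.idx

theorem res_mul {l : Λ} (x y : P.Total) (h : l ≤ (x * y).idx) :
    P.res h (x * y).val =
      P.res (h.trans inf_le_left) x.val * P.res (h.trans inf_le_right) y.val := by
  change P.res h (P.res inf_le_left x.val * P.res inf_le_right y.val) = _
  rw [map_mul, P.res_comp, P.res_comp]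

theorem res_smul {l : Λ} (a : F) (x : P.Total) (h : l ≤ (a • x).idx) :
    P.res h (a • x).val = a • P.res (show l ≤ x.idx from h) x.val :=
  map_smul _ _ _

theorem res_zeroAt {l : Λ} (x : P.Total) (h : l ≤ (zeroAt x).idx) :
    P.res h (zeroAt x).val = 0 := by
  refine (res_add P x (-x) h).trans ?_
  rw [res_neg]
  exact add_neg_cancel _

/-- The additive idempotents are the zero elements of the algebras of the presheaf. -/
theorem res_of_idem {e : P.Total} (he : e + e = e) {l : Λ} (h : l ≤ e.idx) :
    P.res h e.val = 0 := by
  have key : ∀ y : P.Total, y = e → ∀ hy : l ≤ y.idx, P.res hy y.val = P.res h e.val := by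
    rintro y rfl _
    rfl
  have h1 := key _ he (le_inf h h)
  rw [res_add] at h1
  exact add_eq_left.mp h1

theorem natLE_of_eq {V : Type*} [AddCommInverseSemigroup V] {x y : V} (h : x = y) : NatLE x y :=
  ⟨zeroAt y, zeroAt_idem y, by rw [h, add_zeroAt]⟩

theorem zeroAt_congr {x y : P.Total} (h : x.idx = y.idx) : zeroAt x = zeroAt y :=
  ext_forall ((zeroAt_idx x).trans (h.trans (zeroAt_idx y).symm)) fun _ _ _ => by
    rw [res_zeroAt, res_zeroAt]

end Total

open Total

instance : IsInverseSemivectorSpace F P.Total where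
  add_smul' a b x := by
    refine ext_forall (by simp [add_idx, smul_idx]) fun _ _ _ => ?_
    rw [res_smul, res_add, res_smul, res_smul, add_smul]
  smul_add' a x y := by
    refine ext_forall (by simp [add_idx, smul_idx]) fun _ _ _ => ?_
    rw [res_smul, res_add, res_add, res_smul, res_smul, smul_add]
  smul_smul' a b x := by
    refine ext_forall (by simp [smul_idx]) fun _ _ _ => ?_
    rw [res_smul, res_smul, res_smul, mul_smul]
  one_smul' x := by
    refine ext_forall (by simp [smul_idx]) fun _ _ _ => ?_
    rw [res_smul, one_smul]

theorem total_mul_add (x y z : P.Total) : x * (y + z) = x * y + x * z := by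
  refine ext_forall (by simp [add_idx, mul_idx, inf_inf_distrib_left]) fun _ _ _ => ?_
  rw [res_mul, res_add, res_add, res_mul, res_mul, mul_add]

theorem total_add_mul (x y z : P.Total) : (x + y) * z = x * z + y * z := by
  refine ext_forall (by simp [add_idx, mul_idx, inf_inf_distrib_right]) fun _ _ _ => ?_
  rw [res_mul, res_add, res_add, res_mul, res_mul, add_mul]

theorem total_idem_mul {e f : P.Total} (he : e + e = e) : e * f = zeroAt (e + f) := by
  refine ext_forall (by simp [zeroAt_idx, mul_idx, add_idx]) fun _ _ _ => ?_
  rw [res_mul, res_zeroAt, res_of_idem he, zero_mul]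

theorem total_isSemilatticeOfAssociativeAlgebras :
    IsSemilatticeOfAssociativeAlgebras F P.Total where
  smul_mul' a x y _ := by
    refine ext_forall (by simp [mul_idx, smul_idx]) fun _ _ _ => ?_
    rw [res_smul, res_mul, res_mul, res_smul, smul_mul_assoc]
  mul_smul' a x y _ := by
    refine ext_forall (by simp [mul_idx, smul_idx]) fun _ _ _ => ?_
    rw [res_smul, res_mul, res_mul, res_smul, mul_smul_comm]
  mul_add_le x y z := natLE_of_eq (total_mul_add x y z).symm
  add_mul_le x y z := natLE_of_eq (total_add_mul x z y).symm
  mul_idem_add x e z _ := total_mul_add x e z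
  add_idem_mul x e z _ := total_add_mul x e z
  add_le_idem_mul e f he hf := natLE_of_eq (by
    rw [total_idem_mul he, zeroAt_add, zeroAt_of_idem he, zeroAt_of_idem hf])
  idem_mul_le e f he hf := ⟨e, he, by
    rw [total_idem_mul he, zeroAt_add, zeroAt_of_idem he, zeroAt_of_idem hf, add_comm]⟩
  mul_assoc' x y z := by
    refine ext_forall (by simp [mul_idx, inf_assoc]) fun _ _ _ => ?_
    rw [res_mul, res_mul, res_mul, res_mul, mul_assoc]
  zeroAt_mul x y := zeroAt_congr rfl

/-! ### The commutator bracket on the total space -/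

/-- The bracket of `Minus P.Total`, as an operation on `P.Total`. -/
def commutator (x y : P.Total) : P.Total := x * y + -(y * x)

theorem commutator_idx (x y : P.Total) : (commutator x y).idx = x.idx ⊓ y.idx := by
  simp [commutator, add_idx, neg_idx, mul_idx, inf_comm]

/-- The three bounds on `l` are redundant, the first one being equivalent to the other two together;
taking them as separate arguments allows nested commutators to be expanded. -/
theorem res_commutator {l : Λ} (x y : P.Total) (h : l ≤ (commutator x y).idx)
    (hx : l ≤ x.idx) (hy : l ≤ y.idx) : P.res h (commutator x y).val =
      P.res hx x.val * P.res hy y.val - P.res hy y.val * P.res hx x.val := by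
  refine (res_add P (x * y) (-(y * x)) h).trans ?_
  rw [res_neg, res_mul, res_mul, sub_eq_add_neg]

theorem commutator_add (x y z : P.Total) :
    commutator x (y + z) = commutator x y + commutator x z := by
  simp only [commutator, total_mul_add, total_add_mul, aci_neg_add]
  ac_rfl

theorem commutator_skew (x y : P.Total) : commutator x y = -commutator y x := by
  simp only [commutator, aci_neg_add, aci_neg_neg]
  exact add_comm _ _

theorem zeroAt_commutator (x y : P.Total) : zeroAt (commutator x y) = zeroAt (x + y) :=
  zeroAt_congr (commutator_idx x y)

theorem smul_commutator (a : F) (x y : P.Total) :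
    a • commutator x y = commutator (a • x) y := by
  refine ext_forall (by simp [commutator_idx, smul_idx]) fun l hx hy => ?_
  have h : l ≤ x.idx ⊓ y.idx := hx.trans (commutator_idx x y).le
  rw [res_smul, res_commutator x y _ (h.trans inf_le_left) (h.trans inf_le_right),
    res_commutator (a • x) y _ (h.trans inf_le_left) (h.trans inf_le_right), res_smul,
    smul_sub, smul_mul_assoc, mul_smul_comm]

theorem commutator_smul (a : F) (x y : P.Total) :
    a • commutator x y = commutator x (a • y) := by
  refine ext_forall (by simp [commutator_idx, smul_idx]) fun l hx hy => ?_
  have h : l ≤ x.idx ⊓ y.idx := hx.trans (commutator_idx x y).le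
  rw [res_smul, res_commutator x y _ (h.trans inf_le_left) (h.trans inf_le_right),
    res_commutator x (a • y) _ (h.trans inf_le_left) (h.trans inf_le_right), res_smul,
    smul_sub, smul_mul_assoc, mul_smul_comm]

theorem commutator_jacobi (x y z : P.Total) :
    commutator x (commutator y z) + commutator y (commutator z x) +
      commutator z (commutator x y) = zeroAt (x + y + z) := by
  have hidx : (commutator x (commutator y z) + commutator y (commutator z x) +
      commutator z (commutator x y)).idx = x.idx ⊓ y.idx ⊓ z.idx := by
    simp only [add_idx, commutator_idx]
    -- `ac_rfl` also uses that `⊓` is idempotent.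
    ac_rfl
  refine ext_forall (hidx.trans (by simp [zeroAt_idx, add_idx])) fun l hl hl' => ?_
  have h : l ≤ x.idx ⊓ y.idx ⊓ z.idx := hl.trans hidx.le
  have hx := h.trans (inf_le_left.trans inf_le_left)
  have hy := h.trans (inf_le_left.trans inf_le_right)
  have hz := h.trans inf_le_right
  have hyz : l ≤ (commutator y z).idx := (commutator_idx y z).symm ▸ le_inf hy hz
  have hzx : l ≤ (commutator z x).idx := (commutator_idx z x).symm ▸ le_inf hz hx
  have hxy : l ≤ (commutator x y).idx := (commutator_idx x y).symm ▸ le_inf hx hy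
  rw [res_zeroAt, res_add, res_add, res_commutator x _ _ hx hyz, res_commutator y _ _ hy hzx,
    res_commutator z _ _ hz hxy, res_commutator y z _ hy hz, res_commutator z x _ hz hx,
    res_commutator x y _ hx hy]
  noncomm_ring

theorem commutator_idem {e f : P.Total} (he : e + e = e) (hf : f + f = f) :
    e + f = commutator e f := by
  rw [commutator, total_idem_mul he, total_idem_mul hf, ← zeroAt_neg, add_comm f e, zeroAt_neg]
  change e + f = zeroAt (zeroAt (e + f))
  simp only [zeroAt_add, zeroAt_of_idem he, zeroAt_of_idem hf]

theorem minus_total_isSemilatticeOfLieAlgebras :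
    IsSemilatticeOfLieAlgebras F (Minus P.Total) where
  add_smul' := IsInverseSemivectorSpace.add_smul' (V := P.Total)
  smul_add' := IsInverseSemivectorSpace.smul_add' (V := P.Total)
  smul_smul' := IsInverseSemivectorSpace.smul_smul' (V := P.Total)
  one_smul' := IsInverseSemivectorSpace.one_smul' (V := P.Total)
  smul_bracket a x y _ := smul_commutator (P := P) a x y
  bracket_smul a x y _ := commutator_smul (P := P) a x y
  bracket_add_le x y z := natLE_of_eq (commutator_add (P := P) x y z).symm
  bracket_skew := commutator_skew (P := P)
  bracket_idem_add x e z _ := commutator_add (P := P) x e z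
  jacobi_le x y z := natLE_of_eq (commutator_jacobi (P := P) x y z)
  bracket_idem _ _ := commutator_idem (P := P)
  zeroAt_bracket := zeroAt_commutator (P := P)

end AssocAlgPresheaf

/-! ### The embedding -/

section

open AssocAlgPresheaf AssocAlgPresheaf.Total

attribute [local instance 100] LieRing.ofAssociativeRing

theorem zeroAt_add_of_le {V : Type v} [AddCommInverseSemigroup V] {x : V} {e : AddIdem V}
    (h : e ≤ ⟨zeroAt x, zeroAt_idem x⟩) :
    zeroAt (e.val + x) = e.val := by
  rw [zeroAt_add, zeroAt_of_idem e.idem]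
  exact AddIdem.add_of_le h

variable {F : Type u} [Field F] {S : Type v} [AddCommInverseSemigroup S] [SMul F S] [Bracket S S]
  (hS : IsSemilatticeOfLieAlgebras F S) (h2 : ringChar F = 2 → ∀ x : S, ⁅x, x⁆ = zeroAt x)

/-- The canonical map `S_e → U(S_e)`, as a Lie algebra homomorphism. -/
noncomputable def canonicalHom (e : AddIdem S) :
    (liePresheaf hS h2).obj e →ₗ⁅F⁆ UniversalEnvelopingAlgebra F ((liePresheaf hS h2).obj e) :=
  UniversalEnvelopingAlgebra.ι F

/-- The index `0_x` may be replaced by any `e` equal to it. -/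
theorem toEnvelopingSemilattice_eq {x : S} {e : AddIdem S} (h : zeroAt x = e.val) :
    toEnvelopingSemilattice hS h2 x =
      (⟨e, UniversalEnvelopingAlgebra.ι F (⟨x, h⟩ : IdemComponent S e)⟩ :
        EnvelopingSemilattice hS h2) := by
  obtain ⟨e, he⟩ := e
  dsimp only at h
  subst h
  rfl

theorem toEnvelopingSemilattice_injective :
    Function.Injective (toEnvelopingSemilattice hS h2) := by
  intro x y hxy
  have hidx : zeroAt x = zeroAt y :=
    congrArg (fun t : EnvelopingSemilattice hS h2 => t.idx.val) hxy
  let e : AddIdem S := ⟨zeroAt y, zeroAt_idem y⟩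
  rw [toEnvelopingSemilattice_eq hS h2 (e := e) hidx,
    toEnvelopingSemilattice_eq hS h2 (e := e) rfl] at hxy
  have h := PBW.ι_injective (eq_of_heq (Total.mk.inj hxy).2)
  exact congrArg IdemComponent.val h

/-- The restriction of the image of `x` to an index `e` below `0_x` is the image of `e + x` in
`U(S_e)`. -/
theorem res_toEnvelopingSemilattice {x : S} {e : AddIdem S}
    (h : e ≤ (toEnvelopingSemilattice hS h2 x : EnvelopingSemilattice hS h2).idx)
    (he : zeroAt (e.val + x) = e.val) :
    (liePresheaf hS h2).enveloping.res h
        (toEnvelopingSemilattice hS h2 x : EnvelopingSemilattice hS h2).val =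
      canonicalHom hS h2 e (⟨e.val + x, he⟩ : IdemComponent S e) :=
  envelopingMap_ι F _ _

theorem toEnvelopingSemilattice_add (x y : S) : toEnvelopingSemilattice hS h2 (x + y) =
    toEnvelopingSemilattice hS h2 x + toEnvelopingSemilattice hS h2 y := by
  refine Total.ext_forall (P := (liePresheaf hS h2).enveloping)
    (AddIdem.ext (zeroAt_add x y)) fun e h h' => ?_
  have hx := h'.trans inf_le_left
  have hy := h'.trans inf_le_right
  refine Eq.trans ?_ (res_add _ _ _ _).symm
  rw [res_toEnvelopingSemilattice hS h2 h (zeroAt_add_of_le h),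
    res_toEnvelopingSemilattice hS h2 hx (zeroAt_add_of_le hx),
    res_toEnvelopingSemilattice hS h2 hy (zeroAt_add_of_le hy)]
  refine Eq.trans ?_ (LinearMap.map_add (canonicalHom hS h2 e).toLinearMap _ _)
  refine congrArg _ (IdemComponent.ext ?_)
  change e.val + (x + y) = e.val + x + (e.val + y)
  rw [add_add_add_comm, e.idem]

theorem toEnvelopingSemilattice_hom :
    IsLieInverseSemialgebraHom F (toEnvelopingSemilattice hS h2) where
  map_add := toEnvelopingSemilattice_add hS h2
  map_smul a x := by
    refine Total.ext_forall (P := (liePresheaf hS h2).enveloping)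
      (AddIdem.ext (zeroAt_smul F a x)) fun e h h' => ?_
    refine Eq.trans ?_ (res_smul _ _ _).symm
    rw [res_toEnvelopingSemilattice hS h2 h (zeroAt_add_of_le h),
      res_toEnvelopingSemilattice hS h2 h' (zeroAt_add_of_le h')]
    refine Eq.trans ?_ (LinearMap.map_smul (canonicalHom hS h2 e).toLinearMap a _)
    refine congrArg _ (IdemComponent.ext ?_)
    change e.val + a • x = a • (e.val + x)
    rw [hS.smul_add', smul_idem F a e.idem]
  map_neutral z t hz ht := by
    -- Both `φ z` and `t` are idempotents, hence determined by their indices, and each index is the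
    -- greatest idempotent of `S`.
    have hφz := (toEnvelopingSemilattice_add hS h2 z z).symm.trans (congrArg _ (hz z))
    refine Total.ext_forall (P := (liePresheaf hS h2).enveloping) (le_antisymm ?_ ?_)
      fun e h h' => (res_of_idem hφz h).trans (res_of_idem (ht t) h').symm
    · have h := congrArg Total.idx (ht (toEnvelopingSemilattice hS h2 z))
      exact inf_eq_right.mp h
    · let e : AddIdem S := Total.idx t
      refine ⟨e.val, e.idem, ?_⟩
      change e.val = zeroAt z + e.val
      rw [zeroAt_of_idem (hz z), hz]
  map_bracket x y := by
    refine Total.ext_forall (P := (liePresheaf hS h2).enveloping)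
      (AddIdem.ext (zeroAt_bracket_eq hS x y) |>.trans (commutator_idx _ _).symm) fun e h h' => ?_
    have hxy := h'.trans (commutator_idx _ _).le
    have hx := hxy.trans inf_le_left
    have hy := hxy.trans inf_le_right
    refine Eq.trans ?_ (res_commutator _ _ h' hx hy).symm
    rw [res_toEnvelopingSemilattice hS h2 h (zeroAt_add_of_le h),
      res_toEnvelopingSemilattice hS h2 hx (zeroAt_add_of_le hx),
      res_toEnvelopingSemilattice hS h2 hy (zeroAt_add_of_le hy)]
    refine Eq.trans ?_ (LieHom.map_lie (canonicalHom hS h2 e) _ _)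
    refine congrArg _ (IdemComponent.ext ?_)
    change e.val + ⁅x, y⁆ = ⁅e.val + x, e.val + y⁆
    have hxe := zeroAt_add_of_le hx
    have hye := zeroAt_add_of_le hy
    rw [zeroAt_add, zeroAt_of_idem e.idem] at hxe hye
    rw [bracket_add_eq hS, add_bracket_eq hS, add_bracket_eq hS, bracket_idem_right hS _ e.idem,
      bracket_idem_right hS _ e.idem, bracket_idem_left hS _ e.idem, zeroAt_of_idem e.idem,
      e.idem, add_comm (zeroAt x), hxe, e.idem, hye, ← add_assoc, e.idem]

end

theorem corollaryc {F : Type u} [Field F] {S : Type v} [AddCommInverseSemigroup S] [SMul F S]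
    [Bracket S S] (hS : IsSemilatticeOfLieAlgebras F S)
    (h2 : ringChar F = 2 → ∀ x : S, ⁅x, x⁆ = zeroAt x) :
    IsSemilatticeOfAssociativeAlgebras F (EnvelopingSemilattice hS h2) ∧
    IsSemilatticeOfLieAlgebras F (Minus (EnvelopingSemilattice hS h2)) ∧
    IsLieInverseSemialgebraHom F (toEnvelopingSemilattice hS h2) ∧
    Function.Injective (toEnvelopingSemilattice hS h2) := by
  exact ⟨AssocAlgPresheaf.total_isSemilatticeOfAssociativeAlgebras,
    AssocAlgPresheaf.minus_total_isSemilatticeOfLieAlgebras,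
    toEnvelopingSemilattice_hom hS h2, toEnvelopingSemilattice_injective hS h2⟩
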